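/- Let $n\ge 2$ and let $K_n$ be the complete digraph on the cities $1,\dots,n$, with edge set $E$. For a Hamiltonian tour $\tau$ let $\tau(i)$ and $\tau^{-1}(i)$ denote the successor and the predecessor of the city $i$. A city $i$ is a peak if $\tau^{-1}(i)<i$ and $\tau(i)<i$; it is a step-back peak if either $\tau^{-1}(i)<i$, $\tau(i)=i-1$, $\tau^{2}(i)>i$, or $\tau^{-2}(i)>i$, $\tau^{-1}(i)=i-1$, $\tau(i)<i$; a proper peak is a peak that is not a step-back peak. A pyramidal tour is a Hamiltonian tour whose only peak is $n$, and a pyramidal tour with step-backs is a Hamiltonian tour whose only proper peak is $n$. Let $\mathrm{PSB}(n)\subset\mathbb{R}^{E}$ be the convex hull of the characteristic vectors of all pyramidal tours with step-backs. Its 1-skeleton is the graph whose vertices are the vertices of the polytope and whose edges are the one-dimensional faces. Let $\omega(\mathrm{PSB}(n))$ denote the clique number of this graph, i.e. the maximum number of pairwise adjacent vertices. **Theorem.** $\omega(\mathrm{PSB}(n))=\Theta(n^2)$. Moreover, for every $n\ge 2$, $\omega(\mathrm{PSB}(n))\ge\lfloor n/2\rfloor^{2}$, and $\lfloor n/2\rfloor^{2}$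 pairwise adjacent vertices are given by the following tours: for each pair of integers $0\le k,s<\lfloor n/2\rfloor$, the pyramidal tour (without step-backs) that, among the cities $2,\dots,n-1$, visits the cities $2,\dots,k+1$ and $n-s,\dots,n-1$ in ascending order and all the others in descending order. -/

import Mathlib

open Filter Asymptotics

/- The `n` cities `1, …, n` are the elements of `Fin n`: the element `i : Fin n` stands for the city
with label `i + 1`.  A tour `τ` is given by its successor permutation, so that `τ i` is the successor
and `τ⁻¹ i` the predecessor of the city `i`. -/

/-- A Hamiltonian tour: the successor permutation is one single cycle through all cities. -/
def IsHamiltonianTour {n : ℕ} (τ : Equiv.Perm (Fin n)) : Prop :=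
  τ.IsCycle ∧ τ.support = Finset.univ

/-- A peak: both neighbours of `i` on the tour have smaller labels. -/
def IsPeak {n : ℕ} (τ : Equiv.Perm (Fin n)) (i : Fin n) : Prop :=
  τ⁻¹ i < i ∧ τ i < i

/-- A step-back peak, in ascending order (first disjunct) or in descending order (second). -/
def IsStepBackPeak {n : ℕ} (τ : Equiv.Perm (Fin n)) (i : Fin n) : Prop :=
  (τ⁻¹ i < i ∧ (τ i : ℕ) + 1 = i ∧ i < τ (τ i)) ∨
    (i < τ⁻¹ (τ⁻¹ i) ∧ (τ⁻¹ i : ℕ) + 1 = i ∧ τ i < i)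

/-- A proper peak: a peak that is not a step-back peak. -/
def IsProperPeak {n : ℕ} (τ : Equiv.Perm (Fin n)) (i : Fin n) : Prop :=
  IsPeak τ i ∧ ¬ IsStepBackPeak τ i

/-- A pyramidal tour: a Hamiltonian tour whose only peak is the last city. -/
def IsPyramidalTour {n : ℕ} (τ : Equiv.Perm (Fin n)) : Prop :=
  IsHamiltonianTour τ ∧ ∀ i : Fin n, IsPeak τ i ↔ (i : ℕ) + 1 = n

/-- A pyramidal tour with step-backs: a Hamiltonian tour whose only proper peak is the last city. -/
def IsPyramidalTourSB {n : ℕ} (τ : Equiv.Perm (Fin n)) : Prop :=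
  IsHamiltonianTour τ ∧ ∀ i : Fin n, IsProperPeak τ i ↔ (i : ℕ) + 1 = n

/-- The (directed) edges of the complete digraph on `n` cities. -/
abbrev DiEdge (n : ℕ) : Type := {e : Fin n × Fin n // e.1 ≠ e.2}

/-- The characteristic vector of a tour. -/
def charVec {n : ℕ} (τ : Equiv.Perm (Fin n)) : DiEdge n → ℝ :=
  fun e => if τ e.1.1 = e.1.2 then 1 else 0

/-- The polytope of pyramidal tours with step-backs. -/
def PSB (n : ℕ) : Set (DiEdge n → ℝ) :=
  convexHull ℝ {v | ∃ τ : Equiv.Perm (Fin n), IsPyramidalTourSB τ ∧ v = charVec τ}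

/-- The vertices of a convex set `P` in `ℝ^ι`. -/
abbrev PolytopeVertex {ι : Type} (P : Set (ι → ℝ)) : Type := {v : ι → ℝ // v ∈ P.extremePoints ℝ}

/-- The 1-skeleton of a polytope: two distinct vertices are adjacent if the segment between them is
a face, that is, the set of points of `P` at which some linear functional is maximal on `P`. -/
def oneSkeleton {ι : Type} (P : Set (ι → ℝ)) : SimpleGraph (PolytopeVertex P) where
  Adj u v := u ≠ v ∧ IsExposed ℝ P (segment ℝ u.1 v.1)
  symm := ⟨fun u v h => ⟨h.1.symm, by rw [segment_symm]; exact h.2⟩⟩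
  loopless := ⟨fun _ h => h.1 rfl⟩

/-- The polytope has finitely many vertices, so that its 1-skeleton is a finite graph, and its clique
number is a maximum. -/
instance finite_PSB_vertex (n : ℕ) : Finite (PolytopeVertex (PSB n)) := by
  have h : {v : DiEdge n → ℝ | ∃ τ : Equiv.Perm (Fin n),
      IsPyramidalTourSB τ ∧ v = charVec τ}.Finite :=
    (Set.finite_range (fun τ : Equiv.Perm (Fin n) => charVec τ)).subset
      (by rintro v ⟨τ, -, rfl⟩; exact ⟨τ, rfl⟩)
  exact (h.subset extremePoints_convexHull_subset).to_subtype

/-- The tour visits the city `i` in ascending order (used for pyramidal tours without step-backs and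
cities other than the first and the last). -/
def VisitsAscending {n : ℕ} (τ : Equiv.Perm (Fin n)) (i : Fin n) : Prop :=
  τ⁻¹ i < i ∧ i < τ i

/-- The tour visits the city `i` in descending order (used for pyramidal tours without step-backs and
cities other than the first and the last). -/
def VisitsDescending {n : ℕ} (τ : Equiv.Perm (Fin n)) (i : Fin n) : Prop :=
  τ i < i ∧ i < τ⁻¹ i

/-- A pyramidal tour (without step-backs) with encoding `⟨1,…,1,0,…,0,1,…,1⟩` having `k` leading and
`s` trailing ones: among the cities with labels `2, …, n - 1`, those with labels `2, …, k + 1` and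
`n - s, …, n - 1` are visited in ascending order, and all others in descending order. The label of
`i : Fin n` is `i + 1`. -/
def HasEncoding101 {n : ℕ} (τ : Equiv.Perm (Fin n)) (k s : ℕ) : Prop :=
  IsPyramidalTour τ ∧ ∀ i : Fin n, 2 ≤ (i : ℕ) + 1 → (i : ℕ) + 1 < n →
    (((i : ℕ) + 1 ≤ k + 1 ∨ n ≤ (i : ℕ) + 1 + s) → VisitsAscending τ i) ∧
    (¬ ((i : ℕ) + 1 ≤ k + 1 ∨ n ≤ (i : ℕ) + 1 + s) → VisitsDescending τ i)

/-! Upper bound. Call the state of a tour at the cut `i` the set of cities below `i` with an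
out-edge across the cut, together with those with an in-edge across it. Two tours in the same state
can exchange their parts below the cut. The result has only `n` as a proper peak, because that
condition is local, and it is therefore a single cycle. The two recombinations have the same sum as
the two original vectors, so for adjacent tours they give nothing new: the two tours agree below the
cut or on all remaining edges (`agree_of_isExposed`). Moving the cut from bottom to top then shows
that each tour of a clique is determined by its states at some two consecutive cuts
(`exists_cut_determining`). A city with an edge across a cut lies within bounded distance of it,
with at most one exception (`IsPyramidalTourSB.exists_stub_bound`). Hence the cut, the exceptional
city and boundedly many bits encode a tour, which gives a quadratic bound.

Lower bound. A segment between two tours is a face if the union of their edges contains no third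
tour (`isExposed_segment_PSB`). For the encodings `1…10…01…1` with parameters below `⌊n/2⌋`, the
leading and trailing runs cannot meet. A tour in the union follows one of the two on the leading
part (`UnionTour.left`) and, by reversal, one of the two on the trailing part. If the choices agree,
the tour is that one; if they differ, the two given tours coincide. -/

/-! ### Hamiltonian tours, proper peaks and characteristic vectors. -/

section TourBasics

variable {n : ℕ}

theorem IsHamiltonianTour.apply_ne {τ : Equiv.Perm (Fin n)} (h : IsHamiltonianTour τ) (v : Fin n) :
    τ v ≠ v := by
  have : v ∈ τ.support := by rw [h.2]; exact Finset.mem_univ v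
  exact Equiv.Perm.mem_support.1 this

theorem IsHamiltonianTour.inv_apply_ne {τ : Equiv.Perm (Fin n)} (h : IsHamiltonianTour τ)
    (v : Fin n) : τ⁻¹ v ≠ v := fun e => h.apply_ne v (by
  conv_lhs => rw [← e]
  simp)

theorem IsHamiltonianTour.inv {τ : Equiv.Perm (Fin n)} (h : IsHamiltonianTour τ) :
    IsHamiltonianTour τ⁻¹ :=
  ⟨h.1.inv, by rw [Equiv.Perm.support_inv]; exact h.2⟩

/-- A set of cities closed under a Hamiltonian tour is empty or contains every city. -/
theorem IsHamiltonianTour.forall_of_closed {τ : Equiv.Perm (Fin n)} (h : IsHamiltonianTour τ)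
    (S : Fin n → Prop) {a : Fin n} (ha : S a) (hS : ∀ v, S v → S (τ v)) (v : Fin n) : S v := by
  obtain ⟨m, hm⟩ := (h.1.sameCycle (h.apply_ne a) (h.apply_ne v)).exists_nat_pow_eq
  rw [← hm]
  clear hm
  induction m with
  | zero => simpa using ha
  | succ m ih => rw [pow_succ', Equiv.Perm.mul_apply]; exact hS _ ih

/-- A derangement whose only proper peak is the last city is a single cycle: the largest city of
each cycle is a proper peak. -/
theorem isPyramidalTourSB_of_apply_ne {τ : Equiv.Perm (Fin n)} (hn : 0 < n)
    (hne : ∀ v, τ v ≠ v) (hp : ∀ i : Fin n, IsProperPeak τ i ↔ (i : ℕ) + 1 = n) :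
    IsPyramidalTourSB τ := by
  classical
  let N : Fin n := ⟨n - 1, by omega⟩
  have key : ∀ v, τ.SameCycle v N := by
    intro v
    let C : Finset (Fin n) := Finset.univ.filter fun w => τ.SameCycle v w
    have hC : C.Nonempty := ⟨v, by simpa [C] using Equiv.Perm.SameCycle.refl τ v⟩
    set m := C.max' hC with hm
    have hmC : τ.SameCycle v m := by
      have := C.max'_mem hC
      simpa [C] using this
    have hle : ∀ w, τ.SameCycle v w → w ≤ m := fun w hw => C.le_max' w (by simpa [C] using hw)
    have h1 := hle (τ m) (by simpa using hmC)
    have h2 := hle (τ⁻¹ m) (by simpa using hmC)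
    have h3 := hle (τ (τ m)) (by simpa using hmC)
    have h4 := hle (τ⁻¹ (τ⁻¹ m)) (by simpa using hmC)
    have h5 : τ⁻¹ m ≠ m := fun e => hne m (by conv_lhs => rw [← e]; simp)
    have hpk : IsProperPeak τ m := by
      refine ⟨⟨lt_of_le_of_ne h2 h5, lt_of_le_of_ne h1 (hne m)⟩, ?_⟩
      rintro (⟨-, -, h⟩ | ⟨h, -, -⟩)
      · exact absurd h (not_lt.2 h3)
      · exact absurd h (not_lt.2 h4)
    have : m = N := by
      apply Fin.ext
      have := (hp m).1 hpk
      simp only [N]; omega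
    rwa [this] at hmC
  refine ⟨⟨⟨N, hne N, fun y _ => (key y).symm⟩, ?_⟩, hp⟩
  ext v
  simp [hne v]

theorem isProperPeak_iff {τ : Equiv.Perm (Fin n)} {v : Fin n} :
    IsProperPeak τ v ↔ (τ v < v ∧ τ⁻¹ v < v) ∧ ¬ ((τ v : ℕ) + 1 = v ∧ v < τ (τ v)) ∧
      ¬ ((τ⁻¹ v : ℕ) + 1 = v ∧ v < τ⁻¹ (τ⁻¹ v)) := by
  unfold IsProperPeak IsPeak IsStepBackPeak
  generalize (τ v < v) = a, (τ⁻¹ v < v) = b, (v < τ (τ v)) = c, (v < τ⁻¹ (τ⁻¹ v)) = d,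
    ((τ v : ℕ) + 1 = v) = e, ((τ⁻¹ v : ℕ) + 1 = v) = f
  tauto

theorem not_isStepBackPeak_last {τ : Equiv.Perm (Fin n)} {i : Fin n} (hi : (i : ℕ) + 1 = n) :
    ¬ IsStepBackPeak τ i := by
  rintro (⟨-, -, h⟩ | ⟨h, -, -⟩) <;>
  · rw [Fin.lt_def] at h
    omega

theorem isProperPeak_iff_of_isPeak_iff {τ : Equiv.Perm (Fin n)}
    (h : ∀ i : Fin n, IsPeak τ i ↔ (i : ℕ) + 1 = n) (i : Fin n) :
    IsProperPeak τ i ↔ (i : ℕ) + 1 = n :=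
  ⟨fun hi => (h i).1 hi.1, fun hi => ⟨(h i).2 hi, not_isStepBackPeak_last hi⟩⟩

/-- The vector has no diagonal coordinates, so it shows a fixed point only as a zero row; this is
why fixed points are treated apart. -/
theorem charVec_injective : Function.Injective (charVec (n := n)) := by
  intro x y h
  have key : ∀ v, x v ≠ v → y v = x v := by
    intro v hv
    have := congrFun h ⟨(v, x v), fun e => hv e.symm⟩
    simp only [charVec, if_true] at this
    by_contra hne
    simp [hne] at this
  ext v
  by_cases hv : x v = v
  · by_cases hv' : y v = v
    · rw [hv, hv']
    · have := congrFun h ⟨(v, y v), fun e => hv' e.symm⟩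
      simp only [charVec, if_true] at this
      by_contra hne
      have hne : ¬ x v = y v := fun e => hne (by rw [e])
      simp [hne] at this
  · rw [key v hv]

end TourBasics

/-! ### Recombining two tours at a cut. -/

section Recombination

variable {n : ℕ}

/-- The cities below the cut `i` whose successor is not below it. -/
def outStubs (i : ℕ) (x : Equiv.Perm (Fin n)) : Finset (Fin n) :=
  Finset.univ.filter fun v => (v : ℕ) < i ∧ i ≤ x v

theorem mem_outStubs {i : ℕ} {x : Equiv.Perm (Fin n)} {v : Fin n} :
    v ∈ outStubs i x ↔ (v : ℕ) < i ∧ i ≤ x v := by simp [outStubs]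

/-- The tours `x` and `y` have the same state at the cut `i`. -/
def SameCut (i : ℕ) (x y : Equiv.Perm (Fin n)) : Prop :=
  outStubs i x = outStubs i y ∧ outStubs i x⁻¹ = outStubs i y⁻¹

theorem SameCut.symm {i : ℕ} {x y : Equiv.Perm (Fin n)} (h : SameCut i x y) : SameCut i y x :=
  ⟨h.1.symm, h.2.symm⟩

theorem SameCut.trans {i : ℕ} {x y z : Equiv.Perm (Fin n)} (h : SameCut i x y)
    (h' : SameCut i y z) : SameCut i x z :=
  ⟨h.1.trans h'.1, h.2.trans h'.2⟩

theorem SameCut.inv {i : ℕ} {x y : Equiv.Perm (Fin n)} (h : SameCut i x y) :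
    SameCut i x⁻¹ y⁻¹ := ⟨h.2, by simpa using h.1⟩

theorem SameCut.lt_iff {i : ℕ} {x y : Equiv.Perm (Fin n)} (h : SameCut i x y) {v : Fin n}
    (hv : (v : ℕ) < i) : (x v : ℕ) < i ↔ (y v : ℕ) < i := by
  have := Finset.ext_iff.1 h.1 v
  simp only [mem_outStubs, hv, true_and] at this
  omega

/-- Follow `x` on the edges below the cut `i` and `y` on the other edges. -/
def mixFun (i : ℕ) (x y : Equiv.Perm (Fin n)) (v : Fin n) : Fin n :=
  if (v : ℕ) < i ∧ (x v : ℕ) < i then x v else y v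

/-- An edge lies below the cut exactly when its reverse does, so recombining the inverses undoes the
recombination. -/
theorem mixFun_inv_mixFun {i : ℕ} {x y : Equiv.Perm (Fin n)} (h : SameCut i x y) (v : Fin n) :
    mixFun i x⁻¹ y⁻¹ (mixFun i x y v) = v := by
  unfold mixFun
  by_cases hv : (v : ℕ) < i ∧ (x v : ℕ) < i
  · simp [hv]
  · rw [if_neg hv, if_neg]
    · simp
    · rintro ⟨h1, h2⟩
      have h3 := (h.inv.lt_iff h1).1 h2
      simp only [Equiv.Perm.inv_def, Equiv.symm_apply_apply] at h3
      exact hv ⟨h3, (h.lt_iff h3).2 h1⟩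

/-- The tour that follows `x` below the cut `i` and `y` elsewhere. -/
def mix (i : ℕ) (x y : Equiv.Perm (Fin n)) (h : SameCut i x y) : Equiv.Perm (Fin n) where
  toFun := mixFun i x y
  invFun := mixFun i x⁻¹ y⁻¹
  left_inv := mixFun_inv_mixFun h
  right_inv := fun v => by simpa using mixFun_inv_mixFun h.inv v

variable {i : ℕ} {x y : Equiv.Perm (Fin n)}

theorem mix_apply (h : SameCut i x y) (v : Fin n) :
    mix i x y h v = if (v : ℕ) < i ∧ (x v : ℕ) < i then x v else y v := rfl

theorem mix_inv_apply (h : SameCut i x y) (v : Fin n) :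
    (mix i x y h)⁻¹ v = mix i x⁻¹ y⁻¹ h.inv v := rfl

theorem mix_apply_of_lt (h : SameCut i x y) {v : Fin n} (h1 : (v : ℕ) < i)
    (h2 : (x v : ℕ) < i) : mix i x y h v = x v := by rw [mix_apply, if_pos ⟨h1, h2⟩]

theorem mix_apply_of_le (h : SameCut i x y) {v : Fin n} (h1 : i ≤ (v : ℕ)) :
    mix i x y h v = y v := by rw [mix_apply, if_neg]; omega

theorem mix_apply_of_lt_of_le (h : SameCut i x y) {v : Fin n} (h1 : (v : ℕ) < i)
    (h2 : i ≤ (x v : ℕ)) : i ≤ (mix i x y h v : ℕ) := by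
  rw [mix_apply, if_neg (by omega)]
  have := h.lt_iff h1
  omega

/-- Where the recombination departs from `x`, both successors are at or above the cut and hence
exceed `a`. -/
theorem lt_mix_iff (h : SameCut i x y) {v a : Fin n} (hv : (v : ℕ) < i) (ha : (a : ℕ) < i) :
    a < mix i x y h v ↔ a < x v := by
  by_cases hx : (x v : ℕ) < i
  · rw [mix_apply_of_lt h hv hx]
  · have := mix_apply_of_lt_of_le h hv (not_lt.1 hx)
    simp only [Fin.lt_def]
    omega

theorem mix_lt_iff (h : SameCut i x y) {v a : Fin n} (hv : (v : ℕ) < i) (ha : (a : ℕ) < i) :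
    mix i x y h v < a ↔ x v < a := by
  by_cases hx : (x v : ℕ) < i
  · rw [mix_apply_of_lt h hv hx]
  · have := mix_apply_of_lt_of_le h hv (not_lt.1 hx)
    simp only [Fin.lt_def]
    omega

theorem lt_mix_mix_iff_of_lt (h : SameCut i x y) {v : Fin n} (hv : (v : ℕ) < i)
    (hx : (x v : ℕ) < i) : v < mix i x y h (mix i x y h v) ↔ v < x (x v) := by
  rw [mix_apply_of_lt h hv hx, lt_mix_iff h hx hv]

theorem succ_eq_mix_iff_of_lt (h : SameCut i x y) {v : Fin n} (hv : (v : ℕ) < i) :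
    ((mix i x y h v : Fin n) : ℕ) + 1 = v ↔ (x v : ℕ) + 1 = v := by
  by_cases hx : (x v : ℕ) < i
  · rw [mix_apply_of_lt h hv hx]
  · have := mix_apply_of_lt_of_le h hv (not_lt.1 hx)
    omega

theorem stepBack_half_iff_of_lt (h : SameCut i x y) {v : Fin n} (hv : (v : ℕ) < i) :
    (((mix i x y h v : Fin n) : ℕ) + 1 = v ∧ v < mix i x y h (mix i x y h v)) ↔
      ((x v : ℕ) + 1 = v ∧ v < x (x v)) := by
  rw [succ_eq_mix_iff_of_lt h hv]
  refine and_congr_right fun h1 => lt_mix_mix_iff_of_lt h hv (by omega)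

/-- Only the step to `v - 1` can lead below the cut. From there the recombination may follow `x`
instead of `y`, but only when both stay below the cut; then neither exceeds `v` and both sides fail.
-/
theorem stepBack_half_iff_of_le (h : SameCut i x y) {v : Fin n} (hv : i ≤ (v : ℕ)) :
    (((mix i x y h v : Fin n) : ℕ) + 1 = v ∧ v < mix i x y h (mix i x y h v)) ↔
      ((y v : ℕ) + 1 = v ∧ v < y (y v)) := by
  rw [mix_apply_of_le h hv]
  refine and_congr_right fun h1 => ?_
  rw [mix_apply h (y v)]
  split_ifs with h2
  · have := (h.lt_iff h2.1).1 h2.2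
    simp only [Fin.lt_def]
    omega
  · rfl

theorem isProperPeak_mix_of_lt (h : SameCut i x y) {v : Fin n} (hv : (v : ℕ) < i) :
    IsProperPeak (mix i x y h) v ↔ IsProperPeak x v := by
  have e1 := stepBack_half_iff_of_lt h hv
  have e2 := stepBack_half_iff_of_lt h.inv hv
  have e3 := mix_lt_iff h hv hv
  have e4 := mix_lt_iff h.inv hv hv
  rw [isProperPeak_iff, isProperPeak_iff, e3, e1]
  simp only [mix_inv_apply]
  rw [e4, e2]

theorem isProperPeak_mix_of_le (h : SameCut i x y) {v : Fin n} (hv : i ≤ (v : ℕ)) :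
    IsProperPeak (mix i x y h) v ↔ IsProperPeak y v := by
  have e1 := stepBack_half_iff_of_le h hv
  have e2 := stepBack_half_iff_of_le h.inv hv
  have e3 := mix_apply_of_le h hv
  have e4 := mix_apply_of_le h.inv hv
  rw [isProperPeak_iff, isProperPeak_iff, e1, e3]
  simp only [mix_inv_apply]
  rw [e2, e4]

/-- Recombining two pyramidal tours with step-backs that have the same state at a cut gives a
pyramidal tour with step-backs. -/
theorem isPyramidalTourSB_mix (h : SameCut i x y) (hx : IsPyramidalTourSB x)
    (hy : IsPyramidalTourSB y) : IsPyramidalTourSB (mix i x y h) := by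
  have hn : 0 < n := by
    obtain ⟨a, -⟩ := hx.1.1
    exact a.pos
  refine isPyramidalTourSB_of_apply_ne hn (fun v => ?_) fun v => ?_
  · rw [mix_apply]
    split_ifs
    · exact hx.1.apply_ne v
    · exact hy.1.apply_ne v
  · rcases lt_or_ge (v : ℕ) i with hv | hv
    · rw [isProperPeak_mix_of_lt h hv, hx.2]
    · rw [isProperPeak_mix_of_le h hv, hy.2]

/-- In equal states, `x` and `y` leave a city `v` below the cut in the same manner, so the two
recombinations either keep or swap the successors of `v`. -/
theorem charVec_mix_add (h : SameCut i x y) :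
    charVec (mix i x y h) + charVec (mix i y x h.symm) = charVec x + charVec y := by
  funext e
  obtain ⟨⟨v, w⟩, hne⟩ := e
  simp only [Pi.add_apply, charVec, mix_apply]
  by_cases hv : (v : ℕ) < i
  · by_cases hxv : (x v : ℕ) < i
    · have := (h.lt_iff hv).1 hxv
      simp [hv, hxv, this]
    · have : ¬ (y v : ℕ) < i := fun h' => hxv ((h.lt_iff hv).2 h')
      simp [hv, hxv, this, add_comm]
  · simp [hv, add_comm]

end Recombination

/-! ### Consequences of adjacency for recombinations. -/

section Polytope

variable {n : ℕ}

theorem charVec_mem_PSB {τ : Equiv.Perm (Fin n)} (h : IsPyramidalTourSB τ) :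
    charVec τ ∈ PSB n := subset_convexHull ℝ _ ⟨τ, h, rfl⟩

theorem exists_charVec_of_vertex (u : PolytopeVertex (PSB n)) :
    ∃ τ : Equiv.Perm (Fin n), IsPyramidalTourSB τ ∧ u.1 = charVec τ := by
  have h : u.1 ∈ {v | ∃ τ : Equiv.Perm (Fin n), IsPyramidalTourSB τ ∧ v = charVec τ} :=
    extremePoints_convexHull_subset u.2
  exact h

/-- A zero-one vector on the segment between two zero-one vectors is one of its ends. -/
theorem eq_or_eq_of_charVec_mem_segment {x y z : Equiv.Perm (Fin n)}
    (h : charVec z ∈ segment ℝ (charVec x) (charVec y)) : z = x ∨ z = y := by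
  obtain ⟨a, b, ha, hb, hab, hz⟩ := h
  by_cases hxy : x = y
  · subst hxy
    left
    apply charVec_injective
    rw [← hz, ← add_smul, hab, one_smul]
  · obtain ⟨e, he⟩ := Function.ne_iff.1 (fun h => hxy (charVec_injective h))
    have h1 := congrFun hz e
    simp only [Pi.add_apply, Pi.smul_apply, smul_eq_mul] at h1
    -- At a coordinate where the ends differ, the combination equals `a` or `b`, and it must be zero
    -- or one.
    have hab' : a = 0 ∨ b = 0 := by
      simp only [charVec] at h1 he
      split_ifs at h1 he <;> first | exact absurd rfl he | skip
      all_goals first | (left; linarith) | (right; linarith)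
    rcases hab' with rfl | rfl
    · right
      apply charVec_injective
      have : b = 1 := by linarith
      rw [← hz, this]; simp
    · left
      apply charVec_injective
      have : a = 1 := by linarith
      rw [← hz, this]; simp

/-- Recombining two adjacent tours gives nothing new. -/
theorem mix_eq_or_eq_of_isExposed {i : ℕ} {x y : Equiv.Perm (Fin n)} (h : SameCut i x y)
    (hx : IsPyramidalTourSB x) (hy : IsPyramidalTourSB y)
    (hE : IsExposed ℝ (PSB n) (segment ℝ (charVec x) (charVec y))) :
    mix i x y h = x ∨ mix i x y h = y := by
  apply eq_or_eq_of_charVec_mem_segment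
  -- The two recombinations have the same midpoint as `x` and `y`; since the segment is an extreme
  -- subset, it contains both.
  have hm : (1 / 2 : ℝ) • charVec x + (1 / 2 : ℝ) • charVec y ∈
      segment ℝ (charVec x) (charVec y) :=
    ⟨1 / 2, 1 / 2, by norm_num, by norm_num, by norm_num, rfl⟩
  refine hE.isExtreme.2 (charVec_mem_PSB (isPyramidalTourSB_mix h hx hy))
    (charVec_mem_PSB (isPyramidalTourSB_mix h.symm hy hx)) hm
    ⟨1 / 2, 1 / 2, by norm_num, by norm_num, by norm_num, ?_⟩
  rw [← smul_add, ← smul_add, charVec_mix_add]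

/-- `x` and `y` agree on the edges below the cut `i`. -/
def AgreeLeft (i : ℕ) (x y : Equiv.Perm (Fin n)) : Prop :=
  ∀ v : Fin n, (v : ℕ) < i → (x v : ℕ) < i → x v = y v

/-- `x` and `y` agree on the edges that are not below the cut `i`. -/
def AgreeRight (i : ℕ) (x y : Equiv.Perm (Fin n)) : Prop :=
  ∀ v : Fin n, (i ≤ (v : ℕ) ∨ i ≤ (x v : ℕ)) → x v = y v

theorem agree_of_isExposed {i : ℕ} {x y : Equiv.Perm (Fin n)} (h : SameCut i x y)
    (hx : IsPyramidalTourSB x) (hy : IsPyramidalTourSB y)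
    (hE : IsExposed ℝ (PSB n) (segment ℝ (charVec x) (charVec y))) :
    AgreeLeft i x y ∨ AgreeRight i x y := by
  rcases mix_eq_or_eq_of_isExposed h hx hy hE with e | e
  · right
    intro v hv
    have := DFunLike.congr_fun e v
    rw [mix_apply, if_neg (by omega)] at this
    exact this.symm
  · left
    intro v hv hv'
    have := DFunLike.congr_fun e v
    rwa [mix_apply, if_pos ⟨hv, hv'⟩] at this

theorem SameCut.agreeLeft_trans {i : ℕ} {x y z : Equiv.Perm (Fin n)} (h : SameCut i x y)
    (h1 : AgreeLeft i x y) (h2 : AgreeLeft i y z) : AgreeLeft i x z := fun v hv hv' =>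
  (h1 v hv hv').trans (h2 v hv ((h.lt_iff hv).1 hv'))

theorem SameCut.agreeLeft_symm {i : ℕ} {x y : Equiv.Perm (Fin n)} (h : SameCut i x y)
    (h1 : AgreeLeft i x y) : AgreeLeft i y x := fun v hv hv' =>
  (h1 v hv ((h.lt_iff hv).2 hv')).symm

theorem AgreeRight.trans {i : ℕ} {x y z : Equiv.Perm (Fin n)}
    (h1 : AgreeRight i x y) (h2 : AgreeRight i y z) : AgreeRight i x z := fun v hv => by
  have := h1 v hv
  exact this.trans (h2 v (by rwa [← this]))

/-- If two tours have the same states at the cuts `i` and `i + 1`, agree below the first and above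
the second, then they are equal. -/
theorem eq_of_agreeLeft_of_agreeRight {i : ℕ} {x y : Equiv.Perm (Fin n)}
    (hx : IsHamiltonianTour x) (h : SameCut i x y) (h' : SameCut (i + 1) x y)
    (hl : AgreeLeft i x y) (hr : AgreeRight (i + 1) x y) : x = y := by
  have half : ∀ {x y : Equiv.Perm (Fin n)}, SameCut i x y → SameCut (i + 1) x y →
      IsHamiltonianTour x → ∀ v : Fin n, (v : ℕ) < i → (x v : ℕ) = i → x v = y v := by
    intro x y h h' hx v hv hxv
    have h1 : ¬ (y v : ℕ) < i := fun e => by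
      have := (h.lt_iff hv).2 e
      omega
    have h2 : (y v : ℕ) < i + 1 := (h'.lt_iff (by omega)).1 (by omega)
    exact Fin.ext (by omega)
  ext1 v
  by_cases h1 : i + 1 ≤ (v : ℕ) ∨ i + 1 ≤ (x v : ℕ)
  · exact hr v h1
  push Not at h1
  by_cases h2 : (v : ℕ) < i
  · by_cases h3 : (x v : ℕ) < i
    · exact hl v h2 h3
    · exact half h h' hx v h2 (by omega)
  · have hv : (v : ℕ) = i := by omega
    have hne : (x v : ℕ) ≠ v := fun e => hx.apply_ne v (Fin.ext e)
    have := half h.inv h'.inv hx.inv (x v) (by omega) (by simpa using hv)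
    simp only [Equiv.Perm.inv_def, Equiv.symm_apply_apply] at this
    rw [eq_comm, ← Equiv.Perm.eq_inv_iff_eq]
    exact this

end Polytope

/-! ### Counting the states and bounding cliques. -/

section Counting

variable {n : ℕ}

/-- At most one city has its out-edge, and at most one its in-edge, crossing the cut `i`. -/
def IsCleanCut (i : ℕ) (x : Equiv.Perm (Fin n)) : Prop :=
  (∃ a : ℕ, ∀ v ∈ outStubs i x, (v : ℕ) = a) ∧ ∃ a : ℕ, ∀ v ∈ outStubs i x⁻¹, (v : ℕ) = a

theorem IsCleanCut.inv {i : ℕ} {x : Equiv.Perm (Fin n)} (h : IsCleanCut i x) :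
    IsCleanCut i x⁻¹ := ⟨h.2, by simpa using h.1⟩

theorem apply_eq_iff_eq_inv {x : Equiv.Perm (Fin n)} {v w : Fin n} : x v = w ↔ v = x⁻¹ w :=
  (Equiv.Perm.eq_inv_iff_eq).symm

theorem IsProperPeak.inv {x : Equiv.Perm (Fin n)} {v : Fin n} (h : IsProperPeak x⁻¹ v) :
    IsProperPeak x v := by
  rw [isProperPeak_iff] at h ⊢
  rw [inv_inv] at h
  exact ⟨h.1.symm, h.2.symm⟩

theorem isProperPeak_inv {x : Equiv.Perm (Fin n)} {v : Fin n} :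
    IsProperPeak x⁻¹ v ↔ IsProperPeak x v :=
  ⟨IsProperPeak.inv, fun h => IsProperPeak.inv (by simpa using h)⟩

theorem IsPyramidalTourSB.inv {x : Equiv.Perm (Fin n)} (h : IsPyramidalTourSB x) :
    IsPyramidalTourSB x⁻¹ :=
  ⟨h.1.inv, fun i => isProperPeak_inv.trans (h.2 i)⟩

/-- A cut next to an ascending city is clean if the cut above that city is. -/
theorem IsCleanCut.of_succ_of_lt {x : Equiv.Perm (Fin n)} {p : Fin n}
    (h : IsCleanCut ((p : ℕ) + 1) x) (hp : p < x p) : IsCleanCut (p : ℕ) x := by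
  obtain ⟨⟨a, ha⟩, ⟨b, hb⟩⟩ := h
  simp only [mem_outStubs] at ha hb
  rw [Fin.lt_def] at hp
  have hap := ha p (by omega)
  refine ⟨⟨x⁻¹ p, fun v hv => ?_⟩, ⟨b, fun v hv => ?_⟩⟩
  · rw [mem_outStubs] at hv
    by_cases hvp : (x v : ℕ) = p
    · rw [← apply_eq_iff_eq_inv.1 (Fin.ext hvp)]
    · have := ha v (by omega)
      omega
  · rw [mem_outStubs] at hv
    by_cases hvp : (x⁻¹ v : ℕ) = p
    · have : v = x p := by
        have : x⁻¹ v = p := Fin.ext hvp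
        rw [← this]; simp
      rw [← this] at hp
      omega
    · exact hb v (by omega)

/-- The cut just below an ascending step-back is clean if the cut above it is. -/
theorem IsCleanCut.of_succ_of_stepBack {x : Equiv.Perm (Fin n)} {p : Fin n}
    (h : IsCleanCut ((p : ℕ) + 1) x) (h1 : (x p : ℕ) + 1 = p) (h2 : p < x (x p)) :
    IsCleanCut ((p : ℕ) - 1) x := by
  obtain ⟨⟨a, ha⟩, ⟨b, hb⟩⟩ := h
  simp only [mem_outStubs] at ha hb
  rw [Fin.lt_def] at h2
  have hap := ha (x p) (by omega)
  refine ⟨⟨x⁻¹ p, fun v hv => ?_⟩, ⟨b, fun v hv => ?_⟩⟩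
  · rw [mem_outStubs] at hv
    by_cases hvp : (x v : ℕ) = p
    · rw [← apply_eq_iff_eq_inv.1 (Fin.ext hvp)]
    · by_cases hvp' : (x v : ℕ) = x p
      · have : v = p := x.injective (Fin.ext hvp')
        rw [this] at hv
        omega
      · have := ha v (by omega)
        omega
  · rw [mem_outStubs] at hv
    have e : v = x (x⁻¹ v) := by simp
    by_cases hvp : (x⁻¹ v : ℕ) = p
    · rw [Fin.ext hvp] at e
      rw [e] at hv
      omega
    · by_cases hvp' : (x⁻¹ v : ℕ) = x p
      · rw [Fin.ext hvp'] at e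
        rw [← e] at h2
        omega
      · exact hb v (by omega)

theorem IsCleanCut.of_succ_last {x : Equiv.Perm (Fin n)} {p : Fin n}
    (hp : (p : ℕ) + 1 = n) : IsCleanCut (p : ℕ) x := by
  have key : ∀ x : Equiv.Perm (Fin n), ∃ a : ℕ, ∀ v ∈ outStubs p x, (v : ℕ) = a := by
    refine fun x => ⟨x⁻¹ p, fun v hv => ?_⟩
    rw [mem_outStubs] at hv
    have : x v = p := Fin.ext (by omega)
    rw [← apply_eq_iff_eq_inv.1 this]
  exact ⟨key x, key x⁻¹⟩

theorem outStubs_of_length_le {i : ℕ} (hi : n ≤ i) (x : Equiv.Perm (Fin n)) :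
    outStubs i x = ∅ := by
  ext v
  rw [mem_outStubs]
  simp only [Finset.notMem_empty, iff_false]
  omega

/-- A cut is clean, or it goes through a step-back and the cut before it is clean. -/
theorem IsPyramidalTourSB.isCleanCut_or {x : Equiv.Perm (Fin n)} (hx : IsPyramidalTourSB x)
    {i : ℕ} (hi : i ≤ n) : IsCleanCut i x ∨ (1 ≤ i ∧ IsCleanCut (i - 1) x) := by
  induction hi using Nat.decreasingInduction with
  | self => left; simp [IsCleanCut, outStubs_of_length_le]
  | of_succ i hi ih =>
    rcases ih with h | h
    · by_cases hl : i + 1 = n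
      · exact Or.inl (IsCleanCut.of_succ_last (p := ⟨i, hi⟩) hl)
      have hp := mt (hx.2 ⟨i, hi⟩).1 hl
      rw [isProperPeak_iff] at hp
      -- A city other than the last that is not a proper peak has a larger neighbour or is a
      -- step-back peak.
      by_cases h1 : (⟨i, hi⟩ : Fin n) < x ⟨i, hi⟩
      · exact Or.inl (IsCleanCut.of_succ_of_lt (p := ⟨i, hi⟩) h h1)
      by_cases h2 : (⟨i, hi⟩ : Fin n) < x⁻¹ ⟨i, hi⟩
      · exact Or.inl (by simpa using IsCleanCut.of_succ_of_lt (p := ⟨i, hi⟩) h.inv h2 |>.inv)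
      have h1' := lt_of_le_of_ne (not_lt.1 h1) (hx.1.apply_ne _)
      have h2' := lt_of_le_of_ne (not_lt.1 h2) (hx.1.inv_apply_ne _)
      right
      by_cases h3 : (x ⟨i, hi⟩ : ℕ) + 1 = i ∧ (⟨i, hi⟩ : Fin n) < x (x ⟨i, hi⟩)
      · exact ⟨by omega, IsCleanCut.of_succ_of_stepBack (p := ⟨i, hi⟩) h h3.1 h3.2⟩
      by_cases h4 : (x⁻¹ ⟨i, hi⟩ : ℕ) + 1 = i ∧ (⟨i, hi⟩ : Fin n) < x⁻¹ (x⁻¹ ⟨i, hi⟩)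
      · have := (IsCleanCut.of_succ_of_stepBack (p := ⟨i, hi⟩) h.inv h4.1 h4.2).inv
        exact ⟨by omega, by simpa using this⟩
      exact absurd ⟨⟨h1', h2'⟩, h3, h4⟩ hp
    · left
      simpa using h.2

/-- One of the last two cities below a cut is incident to an edge across the cut. -/
theorem IsPyramidalTourSB.exists_stub {x : Equiv.Perm (Fin n)} (hx : IsPyramidalTourSB x)
    {i : ℕ} (h0 : 1 ≤ i) (hi : i < n) :
    ∃ v : Fin n, i ≤ (v : ℕ) + 2 ∧ (v ∈ outStubs i x ∨ v ∈ outStubs i x⁻¹) := by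
  simp only [mem_outStubs]
  obtain ⟨p, rfl⟩ : ∃ p : Fin n, i = p + 1 := ⟨⟨i - 1, by omega⟩, by simp only; omega⟩
  by_cases h1 : (p : ℕ) + 1 ≤ x p
  · exact ⟨p, by omega, Or.inl ⟨by omega, h1⟩⟩
  by_cases h2 : (p : ℕ) + 1 ≤ x⁻¹ p
  · exact ⟨p, by omega, Or.inr ⟨by omega, h2⟩⟩
  have h1' : x p < p := lt_of_le_of_ne (by rw [Fin.le_def]; omega) (hx.1.apply_ne _)
  have h2' : x⁻¹ p < p := lt_of_le_of_ne (by rw [Fin.le_def]; omega) (hx.1.inv_apply_ne _)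
  have hp := mt (hx.2 p).1 (by omega)
  rw [isProperPeak_iff] at hp
  by_cases h3 : (x p : ℕ) + 1 = p ∧ p < x (x p)
  · have := Fin.lt_def.1 h3.2
    exact ⟨x p, by omega, Or.inl ⟨by omega, by omega⟩⟩
  by_cases h4 : (x⁻¹ p : ℕ) + 1 = p ∧ p < x⁻¹ (x⁻¹ p)
  · have := Fin.lt_def.1 h4.2
    exact ⟨x⁻¹ p, by omega, Or.inr ⟨by omega, by omega⟩⟩
  exact absurd ⟨⟨h1', h2'⟩, h3, h4⟩ hp

/-- A clean cut has at most one out-stub and one in-stub, and `exists_stub` puts one of these near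
the cut; `c` is the other. -/
theorem IsPyramidalTourSB.exists_stub_bound_of_isCleanCut {x : Equiv.Perm (Fin n)}
    (hx : IsPyramidalTourSB x) {i : ℕ} (hc : IsCleanCut i x) :
    ∃ c : ℕ, ∀ v : Fin n, (v ∈ outStubs i x ∨ v ∈ outStubs i x⁻¹) → (v : ℕ) = c ∨ i ≤ v + 2 := by
  rcases Nat.lt_or_ge i n with hi | hi
  · rcases Nat.eq_zero_or_pos i with rfl | h0
    · exact ⟨0, fun v _ => Or.inr (by omega)⟩
    obtain ⟨⟨a, ha⟩, ⟨b, hb⟩⟩ := hc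
    obtain ⟨w, hw, hw' | hw'⟩ := hx.exists_stub h0 hi
    · have := ha w hw'
      refine ⟨b, fun v hv => ?_⟩
      rcases hv with hv | hv
      · have := ha v hv
        omega
      · exact Or.inl (hb v hv)
    · have := hb w hw'
      refine ⟨a, fun v hv => ?_⟩
      rcases hv with hv | hv
      · exact Or.inl (ha v hv)
      · have := hb v hv
        omega
  · exact ⟨0, fun v hv => by simp [outStubs_of_length_le hi] at hv⟩

theorem mem_outStubs_of_succ {i : ℕ} {x : Equiv.Perm (Fin n)} {v : Fin n}
    (hv : v ∈ outStubs (i + 1) x) : v ∈ outStubs i x ∨ (v : ℕ) = i := by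
  rw [mem_outStubs] at *
  omega

theorem IsPyramidalTourSB.exists_stub_bound {x : Equiv.Perm (Fin n)}
    (hx : IsPyramidalTourSB x) {i : ℕ} (hi : i ≤ n) :
    ∃ c : ℕ, ∀ v : Fin n, (v ∈ outStubs i x ∨ v ∈ outStubs i x⁻¹) → (v : ℕ) = c ∨ i ≤ v + 3 := by
  rcases hx.isCleanCut_or hi with h | ⟨h0, h⟩
  · obtain ⟨c, hc⟩ := hx.exists_stub_bound_of_isCleanCut h
    exact ⟨c, fun v hv => by have := hc v hv; omega⟩
  · obtain ⟨c, hc⟩ := hx.exists_stub_bound_of_isCleanCut h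
    -- The cut below is clean, and passing to the present cut can add only the city just under it;
    -- this costs one unit of distance.
    obtain ⟨i, rfl⟩ : ∃ j, i = j + 1 := ⟨i - 1, by omega⟩
    simp only [Nat.add_sub_cancel] at hc
    refine ⟨c, fun v hv => ?_⟩
    have h1 : (v ∈ outStubs i x ∨ v ∈ outStubs i x⁻¹) ∨ (v : ℕ) = i := by
      rcases hv with hv | hv
      · have := mem_outStubs_of_succ hv
        tauto
      · have := mem_outStubs_of_succ hv
        tauto
    rcases h1 with h1 | h1
    · have := hc v h1
      omega
    · omega

/-- The membership in `S` of the cities `i`, `i - 1`, `i - 2`, `i - 3` and `c`. -/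
def stubCode (i c : ℕ) (S : Finset (Fin n)) : Fin 5 → Bool := fun t =>
  decide (∃ v ∈ S, if t = 4 then (v : ℕ) = c else (v : ℕ) + t = i)

theorem subset_of_stubCode_eq {i c : ℕ} {S T : Finset (Fin n)}
    (hS : ∀ v ∈ S, (v : ℕ) ≤ i ∧ ((v : ℕ) = c ∨ i ≤ v + 3))
    (h : stubCode i c S = stubCode i c T) : S ⊆ T := by
  intro v hv
  obtain ⟨h1, h2⟩ := hS v hv
  have key : ∀ t : Fin 5, (if t = 4 then (v : ℕ) = c else (v : ℕ) + t = i) → v ∈ T := by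
    intro t ht
    have h3 : stubCode i c S t = true := decide_eq_true ⟨v, hv, ht⟩
    rw [h] at h3
    obtain ⟨w, hw, hwt⟩ := of_decide_eq_true h3
    have : v = w := by
      apply Fin.ext
      split_ifs at ht hwt <;> omega
    rwa [this]
  rcases h2 with h2 | h2
  · exact key 4 (by simpa using h2)
  · refine key ⟨i - v, by omega⟩ ?_
    rw [if_neg]
    · simp only; omega
    · rw [Fin.ext_iff]
      change ¬ i - (v : ℕ) = 4
      omega

theorem eq_of_stubCode_eq {i c : ℕ} {S T : Finset (Fin n)}
    (hS : ∀ v ∈ S, (v : ℕ) ≤ i ∧ ((v : ℕ) = c ∨ i ≤ v + 3))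
    (hT : ∀ v ∈ T, (v : ℕ) ≤ i ∧ ((v : ℕ) = c ∨ i ≤ v + 3))
    (h : stubCode i c S = stubCode i c T) : S = T :=
  (subset_of_stubCode_eq hS h).antisymm (subset_of_stubCode_eq hT h.symm)

/-- Among pairwise adjacent tours, each tour is determined, for some `i`, by its states at the
cuts `i` and `i + 1`. -/
theorem exists_cut_determining {Q : Finset (Equiv.Perm (Fin n))}
    (hQ : ∀ x ∈ Q, IsPyramidalTourSB x)
    (hE : ∀ x ∈ Q, ∀ y ∈ Q, x ≠ y → IsExposed ℝ (PSB n) (segment ℝ (charVec x) (charVec y)))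
    {x : Equiv.Perm (Fin n)} (hx : x ∈ Q) :
    ∃ i < n, ∀ y ∈ Q, SameCut i x y → SameCut (i + 1) x y → x = y := by
  have agree : ∀ i, ∀ y ∈ Q, ∀ z ∈ Q, SameCut i y z → AgreeLeft i y z ∨ AgreeRight i y z := by
    intro i y hy z hz h
    by_cases hyz : y = z
    · exact Or.inl fun v _ _ => by rw [hyz]
    · exact agree_of_isExposed h (hQ y hy) (hQ z hz) (hE y hy z hz hyz)
  -- View the tours in the state of `x` as pairs (part below, rest). Any two share a coordinate, so
  -- all of them share one and the same coordinate with `x`.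
  have rook : ∀ i, (∀ y ∈ Q, SameCut i x y → AgreeLeft i x y) ∨
      (∀ y ∈ Q, SameCut i x y → AgreeRight i x y) := by
    intro i
    by_contra hcon
    push Not at hcon
    obtain ⟨⟨y, hy, hxy, hl⟩, ⟨z, hz, hxz, hr⟩⟩ := hcon
    have hr' := (agree i x hx y hy hxy).resolve_left hl
    have hl' := (agree i x hx z hz hxz).resolve_right hr
    have hyz := hxy.symm.trans hxz
    rcases agree i y hy z hz hyz with h | h
    · exact hl (hxz.agreeLeft_trans hl' (hyz.agreeLeft_symm h))
    · exact hr (AgreeRight.trans hr' h)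
  have hn : 0 < n := by
    obtain ⟨a, -⟩ := (hQ x hx).1.1
    exact a.pos
  by_contra! hcon
  -- At the cut `0` agreement below is vacuous. If it held at `i` and agreement on the rest held at
  -- `i + 1`, the second tour supplied by `hcon i` would equal `x`.
  have left : ∀ i, i < n → ∀ y ∈ Q, SameCut i x y → AgreeLeft i x y := by
    intro i
    induction i with
    | zero => exact fun _ y _ _ v hv => absurd hv (by omega)
    | succ i ih =>
      intro hi
      refine (rook (i + 1)).resolve_right fun hr => ?_
      obtain ⟨y, hy, h1, h2, hne⟩ := hcon i (by omega)
      exact hne (eq_of_agreeLeft_of_agreeRight (hQ x hx).1 h1 h2 (ih (by omega) y hy h1)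
        (hr y hy h2))
  -- At the cut `n` agreement on the rest is vacuous, so the same argument ends in a contradiction.
  obtain ⟨y, hy, h1, h2, hne⟩ := hcon (n - 1) (by omega)
  exact hne (eq_of_agreeLeft_of_agreeRight (hQ x hx).1 h1 h2 (left _ (by omega) y hy h1)
    fun v hv => absurd hv (by omega))

/-- Pairwise adjacent tours number at most quadratically many. -/
theorem card_le_of_pairwise_isExposed {Q : Finset (Equiv.Perm (Fin n))}
    (hQ : ∀ x ∈ Q, IsPyramidalTourSB x)
    (hE : ∀ x ∈ Q, ∀ y ∈ Q, x ≠ y → IsExposed ℝ (PSB n) (segment ℝ (charVec x) (charVec y))) :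
    Q.card ≤ 2 ^ 20 * (n + 1) ^ 2 := by
  have hex : ∀ x : Equiv.Perm (Fin n), ∃ p : Fin (n + 1) × Fin (n + 1), x ∈ Q →
      ((p.1 : ℕ) < n ∧ (∀ y ∈ Q, SameCut p.1 x y → SameCut (p.1 + 1) x y → x = y) ∧
      ∀ v : Fin n, (v ∈ outStubs p.1 x ∨ v ∈ outStubs p.1 x⁻¹) →
        (v : ℕ) = p.2 ∨ (p.1 : ℕ) ≤ v + 3) := by
    intro x
    by_cases hx : x ∈ Q
    · obtain ⟨i, hi, h⟩ := exists_cut_determining hQ hE hx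
      obtain ⟨c, hc⟩ := (hQ x hx).exists_stub_bound hi.le
      -- Capping `c` at `n` is harmless, since every city is smaller than `n`.
      refine ⟨(⟨i, by omega⟩, ⟨min c n, by omega⟩), fun _ => ⟨hi, h, fun v hv => ?_⟩⟩
      have := hc v hv
      simp only
      omega
    · exact ⟨(0, 0), fun h => absurd h hx⟩
  choose p hp using hex
  -- The cut and the exceptional city take `n + 1` values each; four codes of five bits give the
  -- factor `2 ^ 20`.
  let code : Equiv.Perm (Fin n) → (Fin (n + 1) × Fin (n + 1)) ×
      ((Fin 5 → Bool) × (Fin 5 → Bool)) × ((Fin 5 → Bool) × (Fin 5 → Bool)) := fun x =>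
    (p x, (stubCode (p x).1 (p x).2 (outStubs (p x).1 x),
        stubCode (p x).1 (p x).2 (outStubs (p x).1 x⁻¹)),
      (stubCode (p x).1 (p x).2 (outStubs ((p x).1 + 1) x),
        stubCode (p x).1 (p x).2 (outStubs ((p x).1 + 1) x⁻¹)))
  have bound : ∀ x ∈ Q, ∀ v : Fin n, (v ∈ outStubs (p x).1 x ∨ v ∈ outStubs (p x).1 x⁻¹ ∨
      v ∈ outStubs ((p x).1 + 1) x ∨ v ∈ outStubs ((p x).1 + 1) x⁻¹) →
      (v : ℕ) ≤ (p x).1 ∧ ((v : ℕ) = (p x).2 ∨ ((p x).1 : ℕ) ≤ v + 3) := by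
    intro x hx v hv
    have hb := (hp x hx).2.2 v
    simp only [mem_outStubs] at hv hb
    refine ⟨by omega, ?_⟩
    by_cases hvp : (v : ℕ) = (p x).1
    · right; omega
    · exact hb (by omega)
  have hinj : Set.InjOn code Q := by
    intro x hx y hy hxy
    rw [Finset.mem_coe] at hx hy
    simp only [code, Prod.mk.injEq] at hxy
    obtain ⟨h0, ⟨h1, h2⟩, h3, h4⟩ := hxy
    have by' := bound y hy
    rw [← h0] at h1 h2 h3 h4 by'
    have bx := bound x hx
    refine (hp x hx).2.1 y hy ⟨eq_of_stubCode_eq (fun v hv => bx v ?_) (fun v hv => by' v ?_) h1,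
      eq_of_stubCode_eq (fun v hv => bx v ?_) (fun v hv => by' v ?_) h2⟩
      ⟨eq_of_stubCode_eq (fun v hv => bx v ?_) (fun v hv => by' v ?_) h3,
        eq_of_stubCode_eq (fun v hv => bx v ?_) (fun v hv => by' v ?_) h4⟩ <;>
    simp only [hv, true_or, or_true]
  have := Finset.card_le_card_of_injOn code (t := Finset.univ) (fun _ _ => Finset.mem_univ _) hinj
  refine this.trans (le_of_eq ?_)
  simp only [Finset.card_univ, Fintype.card_prod, Fintype.card_fin, Fintype.card_pi,
    Fintype.card_bool, Finset.prod_const]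
  ring

theorem cliqueNum_oneSkeleton_PSB_le (n : ℕ) :
    (oneSkeleton (PSB n)).cliqueNum ≤ 2 ^ 20 * (n + 1) ^ 2 := by
  classical
  obtain ⟨s, hs⟩ := (oneSkeleton (PSB n)).exists_isNClique_cliqueNum
  choose τ hτ hτ' using fun u : PolytopeVertex (PSB n) => exists_charVec_of_vertex u
  have hinj : Function.Injective τ := fun u v h => Subtype.ext (by rw [hτ' u, hτ' v, h])
  rw [← hs.card_eq, ← Finset.card_image_of_injective s hinj]
  refine card_le_of_pairwise_isExposed (fun x hx => ?_) fun x hx y hy hxy => ?_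
  · obtain ⟨u, -, rfl⟩ := Finset.mem_image.1 hx
    exact hτ u
  · obtain ⟨u, hu, rfl⟩ := Finset.mem_image.1 hx
    obtain ⟨v, hv, rfl⟩ := Finset.mem_image.1 hy
    rw [← hτ', ← hτ']
    exact (hs.isClique hu hv fun e => hxy (by rw [e])).2

end Counting

/-! ### The pyramidal tours with encoding `1…10…01…1`. -/

section Encoding

/-- The successor of the city `v` on the pyramidal tour of the cities `0, …, N` whose encoding has
`k` leading and `s` trailing ones. -/
def succ101 (N k s v : ℕ) : ℕ :=
  if v < k then v + 1
  else if v = k then N - s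
  else if v < N - s then (if v = k + 1 then 0 else v - 1)
  else if v < N then v + 1
  else if k + 1 = N - s then 0 else N - s - 1

theorem succ101_le {N k s v : ℕ} (h : k + s < N) : succ101 N k s v ≤ N := by
  unfold succ101; split_ifs <;> omega

/-- Reversing both the direction of travel and the order of the cities exchanges the leading and the
trailing run. This yields the inverse permutation and, later, the reduction of trailing parts to
leading parts. -/
theorem succ101_reverse {N k s v : ℕ} (h : k + s < N) (hv : v ≤ N) :
    N - succ101 N s k (N - succ101 N k s v) = v := by
  unfold succ101; split_ifs <;> omega

/-- The pyramidal tour whose encoding has `k` leading and `s` trailing ones. -/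
def tour101 (N k s : ℕ) (h : k + s < N) : Equiv.Perm (Fin (N + 1)) where
  toFun v := ⟨succ101 N k s v, Nat.lt_succ_of_le (succ101_le h)⟩
  invFun v := ⟨N - succ101 N s k (N - v), by omega⟩
  left_inv v := Fin.ext (succ101_reverse h (by omega))
  right_inv v := Fin.ext (by
    have := succ101_reverse (N := N) (k := s) (s := k) (v := N - v) (by omega) (by omega)
    have := succ101_le (N := N) (k := s) (s := k) (v := N - v) (by omega)
    have := succ101_le (N := N) (v := N - succ101 N s k (N - v)) h
    simp only
    omega)

variable {N k s : ℕ}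

theorem tour101_apply (h : k + s < N) (v : Fin (N + 1)) :
    (tour101 N k s h v : ℕ) = succ101 N k s v := rfl

theorem tour101_inv_apply (h : k + s < N) (v : Fin (N + 1)) :
    ((tour101 N k s h)⁻¹ v : ℕ) = N - succ101 N s k (N - v) := rfl

theorem isPyramidalTour_tour101 (h : k + s < N) : IsPyramidalTour (tour101 N k s h) := by
  have hp : ∀ i : Fin (N + 1), IsPeak (tour101 N k s h) i ↔ (i : ℕ) + 1 = N + 1 := by
    intro i
    have hi : (i : ℕ) ≤ N := by omega
    unfold IsPeak
    rw [Fin.lt_def, Fin.lt_def, tour101_apply, tour101_inv_apply]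
    unfold succ101
    generalize (i : ℕ) = v at hi
    split_ifs <;> omega
  refine ⟨(isPyramidalTourSB_of_apply_ne (by omega) (fun v e => ?_)
    (isProperPeak_iff_of_isPeak_iff hp)).1, hp⟩
  have hv : (v : ℕ) ≤ N := by omega
  have e := congrArg Fin.val e
  rw [tour101_apply] at e
  unfold succ101 at e
  split_ifs at e <;> omega

theorem hasEncoding101_tour101 (h : k + s < N) : HasEncoding101 (tour101 N k s h) k s := by
  refine ⟨isPyramidalTour_tour101 h, fun i h1 h2 => ?_⟩
  unfold VisitsAscending VisitsDescending
  simp only [Fin.lt_def, tour101_apply, tour101_inv_apply]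
  generalize (i : ℕ) = v at h1 h2
  unfold succ101
  constructor <;> intro h3 <;> split_ifs <;> omega

end Encoding

/-! ### Hamiltonian tours in the union of two such tours. -/

section Union

/-- The hypotheses on the successor function `t` of a Hamiltonian tour of the cities `0, …, N`
contained in the union of two of the tours `succ101`, with parameters below `m`. -/
structure UnionTour (N m k s k' s' : ℕ) (t : ℕ → ℕ) : Prop where
  two_mul_le : 2 * m ≤ N + 1
  hk : k < m
  hs : s < m
  hk' : k' < m
  hs' : s' < m
  or : ∀ v ≤ N, t v = succ101 N k s v ∨ t v = succ101 N k' s' v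
  inj : ∀ v ≤ N, ∀ w ≤ N, t v = t w → v = w
  surj : ∀ w ≤ N, ∃ v ≤ N, t v = w
  closed : ∀ S : ℕ → Prop, (∃ v ≤ N, S v) → (∀ v ≤ N, S v → S (t v)) → ∀ v ≤ N, S v

variable {N m k s k' s' : ℕ} {t : ℕ → ℕ}

theorem UnionTour.symm (h : UnionTour N m k s k' s' t) : UnionTour N m k' s' k s t :=
  { h with hk := h.hk', hs := h.hs', hk' := h.hk, hs' := h.hs, or := fun v hv => (h.or v hv).symm }

theorem UnionTour.not_two_cycle (h : UnionTour N m k s k' s' t) (hN : 2 ≤ N) {a b : ℕ}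
    (ha : a ≤ N) (hb : b ≤ N) (hab : t a = b) : t b ≠ a := by
  intro hba
  have := h.closed (fun v => v = a ∨ v = b) ⟨a, ha, Or.inl rfl⟩ (by
    rintro v - (rfl | rfl)
    · exact Or.inr hab
    · exact Or.inl hba)
  have h0 := this 0 (by omega)
  have h1 := this 1 (by omega)
  have h2 := this 2 (by omega)
  omega

theorem succ101_of_lt {v : ℕ} (hv : v < k) : succ101 N k s v = v + 1 := by
  simp [succ101, hv]

theorem succ101_self : succ101 N k s k = N - s := by simp [succ101]

/-- If the tour leaves the shorter ascending run, it follows the first tour on `0, …, k'`. -/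
theorem UnionTour.left_first (h : UnionTour N m k s k' s' t) (hkk : k < k')
    (h0 : t k = N - s) : ∀ v ≤ k', t v = succ101 N k s v := by
  obtain ⟨hm, hk, hs, hk', hs', hor, hinj, hsurj, hcl⟩ := id h
  -- In the union, `j + 1` can be entered only from `j` by the second tour or along the descent of
  -- the first, whose top end is entered from `N`.
  have pred : ∀ j, k ≤ j → j < k' → t j ≠ j + 1 →
      (j + 2 < N - s ∧ t (j + 2) = j + 1) ∨ (j + 2 = N - s ∧ t N = j + 1) := by
    intro j h1 h2 h3
    obtain ⟨u, hu, hut⟩ := hsurj (j + 1) (by omega)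
    have hne : u ≠ j := by rintro rfl; exact h3 hut
    have hou := hor u hu
    rw [hut] at hou
    have : (j + 2 < N - s ∧ u = j + 2) ∨ (j + 2 = N - s ∧ u = N) := by
      unfold succ101 at hou
      rcases hou with e | e <;> split_ifs at e <;> omega
    rcases this with ⟨h4, rfl⟩ | ⟨h4, rfl⟩
    · exact Or.inl ⟨h4, hut⟩
    · exact Or.inr ⟨h4, hut⟩
  -- If `j + 1` is not entered from `j`, it is entered from `j + 2`, and the step back to `j + 2`
  -- would close a 2-cycle.
  have A : ∀ j, k ≤ j → j < k' → t j ≠ j + 1 := by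
    intro j hj
    induction j, hj using Nat.le_induction with
    | base => intro _; omega
    | succ j hj ih =>
      intro hjk
      rcases pred j hj (by omega) (ih (by omega)) with ⟨-, h1⟩ | ⟨h1, -⟩
      · exact h.not_two_cycle (by omega) (by omega) (by omega) h1
      · omega
  intro v hv
  have hov := hor v (by omega)
  rcases hov with e | e
  · exact e
  rcases lt_trichotomy v k with h1 | rfl | h1
  · rw [e, succ101_of_lt h1, succ101_of_lt (by omega)]
  · rw [succ101_self, h0]
  rcases lt_or_eq_of_le hv with h2 | rfl
  · rw [succ101_of_lt h2] at e
    exact absurd e (A v h1.le h2)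
  rw [succ101_self] at e
  exfalso
  obtain ⟨j, rfl⟩ : ∃ j, v = j + 1 := ⟨v - 1, by omega⟩
  rcases Nat.lt_or_ge k j with h3 | h3
  · obtain ⟨i, rfl⟩ : ∃ i, j = i + 1 := ⟨j - 1, by omega⟩
    have e : t (i + 2) = N - s' := e
    rcases pred i (by omega) (by omega) (A i (by omega) (by omega)) with h4 | h4 <;> omega
  · obtain rfl : j = k := by omega
    have h5 := pred j le_rfl (by omega) (A j le_rfl (by omega))
    obtain ⟨u, hu, hut⟩ := hsurj 0 (by omega)
    have hne : u ≠ j + 1 := by rintro rfl; omega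
    have hou := hor u hu
    rw [hut] at hou
    have : (j + 2 < N - s' ∧ u = j + 2) ∨ (j + 2 = N - s' ∧ u = N) := by
      unfold succ101 at hou
      rcases hou with e | e <;> split_ifs at e <;> omega
    -- Here `k' = k + 1`. The predecessors of `k + 1` and `0` each are `k + 2` or `N`: equal ones
    -- contradict that `t` is a function, and the other cases give a 2-cycle or a cycle on `0, …, k,
    -- k + 2`.
    rcases h5 with ⟨h5, h6⟩ | ⟨h5, h6⟩ <;> rcases this with ⟨h7, rfl⟩ | ⟨h7, rfl⟩
    · omega
    · exact h.not_two_cycle (by omega) (by omega) (by omega) h6 (by omega)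
    · have := hcl (fun v => v ≤ j ∨ v = j + 2) ⟨j, by omega, Or.inl le_rfl⟩ (by
        rintro v hv (h8 | rfl)
        · rcases lt_or_eq_of_le h8 with h9 | rfl
          · have := hor v hv
            rw [succ101_of_lt h9, succ101_of_lt (by omega)] at this
            omega
          · omega
        · omega) (j + 1) (by omega)
      omega
    · omega

/-- If the tour stays on the longer ascending run, it follows the second tour on `0, …, k'`. -/
theorem UnionTour.left_second (h : UnionTour N m k s k' s' t) (hkk : k < k')
    (h0 : t k = k + 1) : ∀ v ≤ k', t v = succ101 N k' s' v := by
  obtain ⟨hm, hk, hs, hk', hs', hor, hinj, hsurj, hcl⟩ := id h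
  have low : ∀ v < k, t v = v + 1 := by
    intro v hv
    have := hor v (by omega)
    rw [succ101_of_lt hv, succ101_of_lt (by omega)] at this
    omega
  -- Switching to the first tour at `j + 1` leads back to `j`, a 2-cycle, or from `k + 1` to `0`,
  -- which closes the cycle `0, …, k + 1` too early.
  have back : ∀ j, k ≤ j → j < k' → t j = j + 1 → t (j + 1) ≠ succ101 N k s (j + 1) := by
    intro j h1 h2 h3 h4
    have : (t (j + 1) = j) ∨ (j = k ∧ t (j + 1) = 0) := by
      rw [h4]
      unfold succ101
      split_ifs <;> omega
    rcases this with h5 | ⟨rfl, h5⟩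
    · exact h.not_two_cycle (by omega) (by omega) (by omega) h3 h5
    · have := hcl (fun v => v ≤ j + 1) ⟨0, by omega, by omega⟩ (by
        intro v _ hv
        rcases Nat.lt_or_ge v j with h6 | h6
        · rw [low v h6]; omega
        · have : v = j ∨ v = j + 1 := by omega
          rcases this with rfl | rfl <;> omega) N le_rfl
      omega
  have A : ∀ j, k ≤ j → j < k' → t j = j + 1 := by
    intro j hj
    induction j, hj using Nat.le_induction with
    | base => exact fun _ => h0
    | succ j hj ih =>
      intro hjk
      have := (hor (j + 1) (by omega)).resolve_left (back j hj (by omega) (ih (by omega)))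
      rwa [succ101_of_lt hjk] at this
  intro v hv
  rcases Nat.lt_or_ge v k with h1 | h1
  · rw [low v h1, succ101_of_lt (by omega)]
  rcases lt_or_eq_of_le hv with h2 | rfl
  · rw [A v h1 h2, succ101_of_lt h2]
  · obtain ⟨j, rfl⟩ : ∃ j, v = j + 1 := ⟨v - 1, by omega⟩
    exact (hor (j + 1) (by omega)).resolve_left
      (back j (by omega) (by omega) (A j (by omega) (by omega)))

theorem UnionTour.left_of_lt (h : UnionTour N m k s k' s' t) (hkk : k < k') :
    (∀ v ≤ k', t v = succ101 N k s v) ∨ ∀ v ≤ k', t v = succ101 N k' s' v := by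
  have hk' := h.hk'
  have hm := h.two_mul_le
  have := h.or k (by omega)
  rw [succ101_self, succ101_of_lt hkk] at this
  exact this.imp (h.left_first hkk) (h.left_second hkk)

/-- The tour follows one of the two tours on the first cities. -/
theorem UnionTour.left (h : UnionTour N m k s k' s' t) :
    (∀ v ≤ max k k', t v = succ101 N k s v) ∨ ∀ v ≤ max k k', t v = succ101 N k' s' v := by
  rcases lt_trichotomy k k' with h1 | rfl | h1
  · rw [max_eq_right h1.le]; exact h.left_of_lt h1
  · rw [max_self]
    have hk := h.hk
    have hm := h.two_mul_le
    have low : ∀ v < k, t v = v + 1 := by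
      intro v hv
      have := h.or v (by omega)
      rw [succ101_of_lt hv, succ101_of_lt hv] at this
      omega
    refine (h.or k (by omega)).imp (fun e v hv => ?_) (fun e v hv => ?_) <;>
    · rcases lt_or_eq_of_le hv with h2 | rfl
      · rw [low v h2, succ101_of_lt h2]
      · exact e
  · rw [max_eq_left h1.le]; exact (h.symm.left_of_lt h1).symm

theorem succ101_sub_succ101_sub {w : ℕ} (h : k + s < N) (hw : w ≤ N) :
    succ101 N k s (N - succ101 N s k (N - w)) = w := by
  have h1 := succ101_reverse (N := N) (k := s) (s := k) (v := N - w) (by omega) (by omega)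
  have h2 := succ101_le (N := N) (v := N - succ101 N s k (N - w)) h
  omega

theorem succ101_cases {v : ℕ} (hv : k < v) :
    (v = k + 1 ∧ v < N - s ∧ succ101 N k s v = 0) ∨
    (k + 1 < v ∧ v < N - s ∧ succ101 N k s v = v - 1) ∨
    (N - s ≤ v ∧ v < N ∧ succ101 N k s v = v + 1) ∨
    (N ≤ v ∧ k + 1 = N - s ∧ succ101 N k s v = 0) ∨
    (N ≤ v ∧ k + 1 ≠ N - s ∧ succ101 N k s v = N - s - 1) := by
  unfold succ101
  split_ifs <;> omega

/-- Away from the two ends both tours simply descend, so they can disagree only where one of the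
descents ends; there injectivity against the known leading edges decides. -/
theorem UnionTour.eq_first (h : UnionTour N m k s k' s' t)
    (hl : ∀ v ≤ max k k', t v = succ101 N k s v)
    (hr : ∀ v ≤ N, N - t v ≤ max s s' → t v = succ101 N k s v) :
    ∀ v ≤ N, t v = succ101 N k s v := by
  obtain ⟨hm, hk, hs, hk', hs', hor, hinj, hsurj, -⟩ := id h
  intro v hv
  rcases hor v hv with e | e
  · exact e
  by_cases h1 : v ≤ max k k'
  · exact hl v h1
  by_cases h2 : N - t v ≤ max s s'
  · exact hr v hv h2
  -- If the first tour enters the trailing part from `v`, then the city entered has its predecessor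
  -- under `t` prescribed by `hr`, and this is `v`.
  by_cases h3 : N - succ101 N k s v ≤ max s s'
  · obtain ⟨u, hu, hut⟩ := hsurj (succ101 N k s v) (succ101_le (by omega))
    have h4 := hr u hu (by rwa [hut])
    have h5 := succ101_reverse (N := N) (k := k) (s := s) (by omega) hu
    have h6 := succ101_reverse (N := N) (k := k) (s := s) (by omega) hv
    have : u = v := by rw [← h5, ← h4, hut, h6]
    rwa [this] at h4
  by_contra hne
  rw [e] at hne h2
  have key : (k < k' ∧ succ101 N k' s' v = 0) ∨ (k' < k ∧ succ101 N k' s' v = k) := by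
    have hx := succ101_cases (N := N) (s := s) (k := k) (v := v) (by omega)
    have hy := succ101_cases (N := N) (s := s') (k := k') (v := v) (by omega)
    generalize succ101 N k s v = a at *
    generalize succ101 N k' s' v = b at *
    rcases hx with hx | hx | hx | hx | hx <;> rcases hy with hy | hy | hy | hy | hy <;> omega
  rcases key with ⟨h4, h5⟩ | ⟨h4, h5⟩
  · have h6 := hl (k + 1) (by omega)
    have h7 : succ101 N k s (k + 1) = 0 := by unfold succ101; split_ifs <;> omega
    have := hinj (k + 1) (by omega) v hv (by omega)
    omega
  · have h6 := hl (k - 1) (by omega)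
    rw [succ101_of_lt (by omega)] at h6
    have := hinj (k - 1) (by omega) v hv (by omega)
    omega

/-- The jump from the leading to the trailing run belongs to both regions, so both tours must make
it alike. -/
theorem UnionTour.eq_of_cross (h : UnionTour N m k s k' s' t)
    (hl : ∀ v ≤ max k k', t v = succ101 N k s v)
    (hr : ∀ v ≤ N, N - t v ≤ max s s' → t v = succ101 N k' s' v) : k = k' ∧ s = s' := by
  obtain ⟨hm, hk, hs, hk', hs', hor, hinj, hsurj, -⟩ := id h
  have h1 := hl k (by omega)
  rw [succ101_self] at h1
  have h2 := hr k (by omega) (by omega)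
  rcases lt_trichotomy k k' with h3 | rfl | h3
  · rw [succ101_of_lt h3] at h2
    omega
  · rw [succ101_self] at h2
    omega
  · obtain ⟨u, hu, hut⟩ := hsurj (N - s') (by omega)
    have h4 := hr u hu (by omega)
    have h5 : u = k' := by
      rw [hut] at h4
      unfold succ101 at h4
      split_ifs at h4 <;> omega
    have h6 := hl k' (by omega)
    rw [succ101_of_lt h3, ← h5] at h6
    omega

/-- Here `r` is the reversed tour: its leading part is the set of edges of `t` that enter the
trailing cities. -/
theorem UnionTour.right (h : UnionTour N m k s k' s' t) {r : ℕ → ℕ}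
    (ht : ∀ v ≤ N, t v ≤ N) (hrt : ∀ v ≤ N, N - r (N - t v) = v)
    (hl : ∀ w ≤ max s s', r w = succ101 N s k w) :
    ∀ v ≤ N, N - t v ≤ max s s' → t v = succ101 N k s v := by
  intro v hv h1
  have h2 := hrt v hv
  rw [hl _ h1] at h2
  have := h.two_mul_le
  have := h.hk
  have := h.hs
  rw [← succ101_sub_succ101_sub (N := N) (k := k) (s := s) (by omega) (ht v hv), h2]

/-- A Hamiltonian tour in the union of two of the tours `succ101` is one of them. -/
theorem UnionTour.eq_or_eq {r : ℕ → ℕ} (h : UnionTour N m k s k' s' t)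
    (hr : UnionTour N m s k s' k' r) (hrt : ∀ v ≤ N, N - r (N - t v) = v) :
    (∀ v ≤ N, t v = succ101 N k s v) ∨ ∀ v ≤ N, t v = succ101 N k' s' v := by
  have ht : ∀ v ≤ N, t v ≤ N := by
    intro v hv
    have := h.two_mul_le
    have := h.hk
    have := h.hs
    have := h.hk'
    have := h.hs'
    rcases h.or v hv with e | e <;> rw [e] <;> exact succ101_le (by omega)
  rcases h.left with h1 | h1 <;> rcases hr.left with h2 | h2
  · exact Or.inl (h.eq_first h1 (h.right ht hrt h2))
  · rw [max_comm] at h2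
    have h3 := h.symm.right ht hrt h2
    rw [max_comm] at h3
    obtain ⟨rfl, rfl⟩ := h.eq_of_cross h1 h3
    exact Or.inl (h.eq_first h1 h3)
  · rw [max_comm] at h1
    have h3 := h.right ht hrt h2
    rw [max_comm] at h3
    obtain ⟨rfl, rfl⟩ := h.symm.eq_of_cross h1 h3
    exact Or.inl (h.eq_first h1 h3)
  · rw [max_comm] at h1 h2
    exact Or.inr (h.symm.eq_first h1 (h.symm.right ht hrt h2))

/-- A permutation of `Fin (N + 1)` as a function on the natural numbers. -/
def natFun (τ : Equiv.Perm (Fin (N + 1))) (v : ℕ) : ℕ :=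
  if h : v < N + 1 then (τ ⟨v, h⟩ : ℕ) else 0

theorem natFun_val (τ : Equiv.Perm (Fin (N + 1))) (v : Fin (N + 1)) : natFun τ v = τ v := by
  rw [natFun, dif_pos v.isLt]

theorem unionTour_natFun {τ : Equiv.Perm (Fin (N + 1))} (hτ : IsHamiltonianTour τ)
    (hm : 2 * m ≤ N + 1) (hk : k < m) (hs : s < m) (hk' : k' < m) (hs' : s' < m)
    (hor : ∀ v : Fin (N + 1), (τ v : ℕ) = succ101 N k s v ∨ (τ v : ℕ) = succ101 N k' s' v) :
    UnionTour N m k s k' s' (natFun τ) where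
  two_mul_le := hm
  hk := hk
  hs := hs
  hk' := hk'
  hs' := hs'
  or v hv := by
    have := hor ⟨v, by omega⟩
    rwa [← natFun_val] at this
  inj v hv w hw h := by
    have := natFun_val τ ⟨v, by omega⟩
    have := natFun_val τ ⟨w, by omega⟩
    have : τ ⟨v, by omega⟩ = τ ⟨w, by omega⟩ := Fin.ext (by simp only at *; omega)
    simpa using this
  surj w hw := by
    refine ⟨τ⁻¹ ⟨w, by omega⟩, by omega, ?_⟩
    rw [natFun_val]
    simp
  closed S hS hcl v hv := by
    obtain ⟨a, ha, hSa⟩ := hS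
    refine hτ.forall_of_closed (fun u => S u) (a := ⟨a, by omega⟩) hSa (fun u hu => ?_)
      ⟨v, by omega⟩
    have := hcl u (by omega) hu
    rwa [natFun_val] at this

theorem IsHamiltonianTour.conj {n : ℕ} {τ : Equiv.Perm (Fin n)} (h : IsHamiltonianTour τ)
    (g : Equiv.Perm (Fin n)) : IsHamiltonianTour (g * τ * g⁻¹) := by
  refine ⟨h.1.conj, ?_⟩
  rw [Equiv.Perm.support_conj, h.2, Finset.map_univ_equiv]

/-- A Hamiltonian tour in the union of two tours `tour101` is one of them. -/
theorem eq_tour101_or_eq_tour101 (hm : 2 * m ≤ N + 1) (hk : k < m) (hs : s < m) (hk' : k' < m)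
    (hs' : s' < m) (h : k + s < N) (h' : k' + s' < N) {τ : Equiv.Perm (Fin (N + 1))}
    (hτ : IsHamiltonianTour τ) (hor : ∀ v, τ v = tour101 N k s h v ∨ τ v = tour101 N k' s' h' v) :
    τ = tour101 N k s h ∨ τ = tour101 N k' s' h' := by
  have hU := unionTour_natFun hτ hm hk hs hk' hs' fun v =>
    (hor v).imp (fun e => by rw [e, tour101_apply]) (fun e => by rw [e, tour101_apply])
  have hrev : ∀ v : Fin (N + 1), ((Fin.rev v : Fin (N + 1)) : ℕ) = N - v := fun v => by
    rw [Fin.val_rev]; omega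
  set σ : Equiv.Perm (Fin (N + 1)) := Fin.revPerm * τ⁻¹ * Fin.revPerm⁻¹ with hσ
  have hσv : ∀ v, σ v = Fin.rev (τ⁻¹ (Fin.rev v)) := fun v => rfl
  have hV : UnionTour N m s k s' k' (natFun σ) := by
    refine unionTour_natFun (hτ.inv.conj _) hm hs hk hs' hk' fun v => ?_
    have e : Fin.rev v = τ (τ⁻¹ (Fin.rev v)) := by simp
    rw [hσv, hrev]
    refine (hor (τ⁻¹ (Fin.rev v))).imp (fun e' => ?_) (fun e' => ?_) <;>
    · rw [← e, ← Equiv.Perm.inv_eq_iff_eq, eq_comm] at e'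
      rw [e', tour101_inv_apply, hrev]
      have h1 : N - (N - (v : ℕ)) = v := by omega
      have h2 : succ101 N s k v ≤ N := succ101_le (by omega)
      have h3 : succ101 N s' k' v ≤ N := succ101_le (by omega)
      rw [h1]
      omega
  have hrt : ∀ v ≤ N, N - natFun σ (N - natFun τ v) = v := by
    intro v hv
    obtain ⟨u, rfl⟩ : ∃ u : Fin (N + 1), v = u := ⟨⟨v, by omega⟩, rfl⟩
    rw [natFun_val, ← hrev, natFun_val, hσv, Fin.rev_rev, hrev]
    simp only [Equiv.Perm.inv_def, Equiv.symm_apply_apply]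
    omega
  refine (hU.eq_or_eq hV hrt).imp (fun e => ?_) (fun e => ?_) <;>
  · ext v
    rw [tour101_apply, ← e v (by omega), natFun_val]

end Union

/-! ### Adjacency and the quadratic clique. -/

section Adjacency

/-- If no further tour lies in the union of the tours `x` and `y`, then the segment between them
is a face. -/
theorem isExposed_segment_PSB {n : ℕ} {x y : Equiv.Perm (Fin n)} (hx : IsPyramidalTourSB x)
    (hy : IsPyramidalTourSB y) (h : ∀ τ : Equiv.Perm (Fin n), IsPyramidalTourSB τ →
      (∀ v, τ v = x v ∨ τ v = y v) → τ = x ∨ τ = y) :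
    IsExposed ℝ (PSB n) (segment ℝ (charVec x) (charVec y)) := by
  classical
  -- The functional charges every edge outside the union of `x` and `y`, so among the tours it
  -- vanishes only at these two.
  let c : DiEdge n → ℝ := fun e => if x e.1.1 = e.1.2 ∨ y e.1.1 = e.1.2 then 0 else -1
  let l : StrongDual ℝ (DiEdge n → ℝ) := ∑ e, c e • ContinuousLinearMap.proj e
  have hl : ∀ p, l p = ∑ e, c e * p e := fun p => by
    simp [l]
  have hle : ∀ (τ : Equiv.Perm (Fin n)) (e : DiEdge n), c e * charVec τ e ≤ 0 := by
    intro τ e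
    simp only [c, charVec]
    split_ifs <;> norm_num
  have hlt : ∀ τ : Equiv.Perm (Fin n), IsPyramidalTourSB τ →
      l (charVec τ) < 0 ∨ τ = x ∨ τ = y := by
    intro τ hτ
    by_cases hu : ∀ v, τ v = x v ∨ τ v = y v
    · exact Or.inr (h τ hτ hu)
    · left
      push Not at hu
      obtain ⟨v, h1, h2⟩ := hu
      rw [hl]
      refine Finset.sum_neg' (fun e _ => hle τ e)
        ⟨⟨(v, τ v), (hτ.1.apply_ne v).symm⟩, Finset.mem_univ _, ?_⟩
      simp [c, charVec, h1.symm, h2.symm]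
  have hx0 : l (charVec x) = 0 := by
    rw [hl]
    refine Finset.sum_eq_zero fun e _ => ?_
    simp only [c, charVec]
    split_ifs <;> simp_all
  have hy0 : l (charVec y) = 0 := by
    rw [hl]
    refine Finset.sum_eq_zero fun e _ => ?_
    simp only [c, charVec]
    split_ifs <;> simp_all
  have hseg : ∀ p ∈ segment ℝ (charVec x) (charVec y), l p = 0 := by
    rintro p ⟨a, b, -, -, -, rfl⟩
    simp [hx0, hy0]
  -- Adding to the open half-space a convex part of its boundary keeps it convex, so checking the
  -- generating tours suffices to place the whole polytope in this set.
  have hconv : Convex ℝ ({p | l p < 0} ∪ segment ℝ (charVec x) (charVec y)) := by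
    intro p hp q hq a b ha hb hab
    have hp0 : l p ≤ 0 := hp.elim (fun h => le_of_lt h) fun h => (hseg p h).le
    have hq0 : l q ≤ 0 := hq.elim (fun h => le_of_lt h) fun h => (hseg q h).le
    rcases eq_or_lt_of_le ha with rfl | ha'
    · have : b = 1 := by linarith
      simpa [this] using hq
    rcases eq_or_lt_of_le hb with rfl | hb'
    · have : a = 1 := by linarith
      simpa [this] using hp
    have hlin : l (a • p + b • q) = a * l p + b * l q := by simp
    rcases hp with hp | hp
    · left
      change l _ < 0
      have hp : l p < 0 := hp
      rw [hlin]
      nlinarith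
    rcases hq with hq | hq
    · left
      change l _ < 0
      have hq : l q < 0 := hq
      rw [hlin]
      nlinarith
    · right
      exact convex_segment _ _ hp hq ha hb hab
  have hsub : PSB n ⊆ {p | l p < 0} ∪ segment ℝ (charVec x) (charVec y) := by
    refine convexHull_min ?_ hconv
    rintro v ⟨τ, hτ, rfl⟩
    rcases hlt τ hτ with h1 | rfl | rfl
    · exact Or.inl h1
    · exact Or.inr (left_mem_segment ℝ _ _)
    · exact Or.inr (right_mem_segment ℝ _ _)
  intro _
  refine ⟨l, Set.Subset.antisymm (fun p hp => ⟨?_, fun q hq => ?_⟩) fun p hp => ?_⟩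
  · exact (convex_convexHull ℝ _).segment_subset (charVec_mem_PSB hx) (charVec_mem_PSB hy) hp
  · rw [hseg p hp]
    exact (hsub hq).elim (fun h => le_of_lt h) fun h => (hseg q h).le
  · refine (hsub hp.1).resolve_left fun hneg => ?_
    have hneg : l p < 0 := hneg
    have := hp.2 _ (charVec_mem_PSB hx)
    linarith

/-- This is the degenerate segment `x = y`: the union contains no tour but `x`. -/
theorem charVec_mem_extremePoints {n : ℕ} {x : Equiv.Perm (Fin n)} (hx : IsPyramidalTourSB x) :
    charVec x ∈ (PSB n).extremePoints ℝ := by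
  have := isExposed_segment_PSB hx hx fun τ _ h => Or.inl (Equiv.ext fun v => by simpa using h v)
  rw [segment_same] at this
  exact isExtreme_singleton.1 this.isExtreme

theorem IsPyramidalTour.isPyramidalTourSB {n : ℕ} {x : Equiv.Perm (Fin n)}
    (h : IsPyramidalTour x) : IsPyramidalTourSB x :=
  ⟨h.1, isProperPeak_iff_of_isPeak_iff h.2⟩

theorem exists_pairwise_adj_vertices (n : ℕ) :
    ∃ x : Fin (n / 2) × Fin (n / 2) → PolytopeVertex (PSB n),
      (∀ p, ∃ τ : Equiv.Perm (Fin n), HasEncoding101 τ p.1 p.2 ∧ (x p).1 = charVec τ) ∧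
      ∀ p q, p ≠ q → (oneSkeleton (PSB n)).Adj (x p) (x q) := by
  rcases n with _ | N
  · exact ⟨fun p => absurd p.1.isLt (by omega), fun p => absurd p.1.isLt (by omega),
      fun p => absurd p.1.isLt (by omega)⟩
  have hp : ∀ p : Fin ((N + 1) / 2) × Fin ((N + 1) / 2), (p.1 : ℕ) + p.2 < N := fun p => by omega
  have hSB := fun p => (isPyramidalTour_tour101 (hp p)).isPyramidalTourSB
  refine ⟨fun p => ⟨charVec (tour101 N p.1 p.2 (hp p)), charVec_mem_extremePoints (hSB p)⟩,
    fun p => ⟨_, hasEncoding101_tour101 (hp p), rfl⟩, fun p q hpq => ⟨fun e => hpq ?_, ?_⟩⟩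
  · have e := charVec_injective (congrArg Subtype.val e)
    have e0 : ∀ v ≤ N, succ101 N p.1 p.2 v = succ101 N q.1 q.2 v := fun v hv => by
      have := congrArg Fin.val (DFunLike.congr_fun e ⟨v, by omega⟩)
      rwa [tour101_apply, tour101_apply] at this
    have e1 := e0 p.1 (by omega)
    have e2 := e0 q.1 (by omega)
    rw [succ101_self] at e1 e2
    refine Prod.ext (Fin.ext ?_) (Fin.ext ?_) <;>
    · rcases lt_trichotomy (p.1 : ℕ) q.1 with h | h | h
      · rw [succ101_of_lt h] at e1
        omega
      · rw [← h, succ101_self] at e1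
        omega
      · rw [succ101_of_lt h] at e2
        omega
  · exact isExposed_segment_PSB (hSB p) (hSB q) fun τ hτ hor =>
      eq_tour101_or_eq_tour101 (m := (N + 1) / 2) (by omega) p.1.isLt p.2.isLt q.1.isLt q.2.isLt
        (hp p) (hp q) hτ.1 hor

theorem sq_le_cliqueNum_oneSkeleton_PSB (n : ℕ) :
    (n / 2) ^ 2 ≤ (oneSkeleton (PSB n)).cliqueNum := by
  classical
  have := Fintype.ofFinite (PolytopeVertex (PSB n))
  obtain ⟨x, -, hadj⟩ := exists_pairwise_adj_vertices n
  have hinj : Function.Injective x := fun p q h => by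
    by_contra hpq
    exact (hadj p q hpq).ne h
  have hc : (oneSkeleton (PSB n)).IsClique (Finset.univ.image x : Finset _) := by
    intro u hu v hv huv
    simp only [Finset.coe_image, Finset.coe_univ, Set.image_univ, Set.mem_range] at hu hv
    obtain ⟨p, rfl⟩ := hu
    obtain ⟨q, rfl⟩ := hv
    exact hadj p q fun e => huv (by rw [e])
  have := hc.card_le_cliqueNum
  rw [Finset.card_image_of_injective _ hinj] at this
  simpa [sq] using this

end Adjacency

/-- The clique number of the 1-skeleton of `PSB(n)` is `Θ(n²)`; for every `n` it is at least `⌊n/2⌋²`,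
and this many pairwise adjacent vertices are given by the pyramidal tours without step-backs with
encodings `1…1 0…0 1…1`, with `k` leading and `s` trailing ones, `0 ≤ k, s < ⌊n/2⌋`. -/
theorem theorem4 :
    ((fun n : ℕ => ((oneSkeleton (PSB n)).cliqueNum : ℝ)) =Θ[atTop] (fun n : ℕ => (n : ℝ) ^ 2)) ∧
    (∀ n : ℕ, (n / 2) ^ 2 ≤ (oneSkeleton (PSB n)).cliqueNum) ∧
    (∀ n : ℕ, ∃ x : Fin (n / 2) × Fin (n / 2) → PolytopeVertex (PSB n),
      (∀ p, ∃ τ : Equiv.Perm (Fin n), HasEncoding101 τ p.1 p.2 ∧ (x p).1 = charVec τ) ∧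
      ∀ p q, p ≠ q → (oneSkeleton (PSB n)).Adj (x p) (x q)) := by
  refine ⟨⟨?_, ?_⟩, sq_le_cliqueNum_oneSkeleton_PSB, exists_pairwise_adj_vertices⟩
  -- The extra factor 4 absorbs `(n + 1) ^ 2 ≤ (2 * n) ^ 2`.
  · refine IsBigO.of_bound (2 ^ 22) ?_
    filter_upwards [eventually_ge_atTop 1] with n hn
    have h1 := cliqueNum_oneSkeleton_PSB_le n
    have h2 : (n + 1) ^ 2 ≤ (2 * n) ^ 2 := Nat.pow_le_pow_left (by omega) 2
    have h3 : (oneSkeleton (PSB n)).cliqueNum ≤ 2 ^ 22 * n ^ 2 := by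
      calc _ ≤ 2 ^ 20 * (n + 1) ^ 2 := h1
        _ ≤ 2 ^ 20 * (2 * n) ^ 2 := Nat.mul_le_mul_left _ h2
        _ = 2 ^ 22 * n ^ 2 := by ring
    rw [Real.norm_of_nonneg (by positivity), Real.norm_of_nonneg (by positivity)]
    exact_mod_cast h3
  -- From `n ≥ 2` on, `n ≤ 3 * (n / 2)`; the extreme case is `n = 3`.
  · refine IsBigO.of_bound 9 ?_
    filter_upwards [eventually_ge_atTop 2] with n hn
    have h1 := sq_le_cliqueNum_oneSkeleton_PSB n
    have h2 : n ^ 2 ≤ (3 * (n / 2)) ^ 2 := Nat.pow_le_pow_left (by omega) 2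
    have h3 : n ^ 2 ≤ 9 * (oneSkeleton (PSB n)).cliqueNum := by
      calc n ^ 2 ≤ (3 * (n / 2)) ^ 2 := h2
        _ = 9 * (n / 2) ^ 2 := by ring
        _ ≤ _ := Nat.mul_le_mul_left _ h1
    rw [Real.norm_of_nonneg (by positivity), Real.norm_of_nonneg (by positivity)]
    exact_mod_cast h3
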